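/- Let $p$ be a prime. A finite group $G$ with derived subgroup $G'$ is called a Camina group if for every $g \in G \setminus G'$ the conjugacy class of $g$ is the coset $gG'$; a Camina $p$-group is a Camina group that is a finite $p$-group. Let $G$ be a Camina $p$-group of nilpotence class $3$, and put $G_3 = [G',G]$. For every subgroup $N \le G_3$ with $|G_3:N| = p$ (such an $N$ is central, hence normal, in $G$) let $C(N)$ be the subgroup of $G$ containing $N$ with $C(N)/N = C_{G/N}(G'/N)$, and let $\mathcal{C}(G) = \{\, C(N) : N \le G_3,\ |G_3:N| = p \,\}$. Suppose that $C_G(G') = G'$. If $|\mathcal{C}(G)| \le p^a + 1$ for some integer $a \ge 1$, then $|G_3| \le p^{2a}$. -/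

import Mathlib

/-- `G` is a Camina group: the conjugacy class of every `g ∈ G \ G'` is the coset `g G'`. -/
def IsCaminaGroup (G : Type*) [Group G] : Prop :=
  ∀ g : G, g ∉ commutator G → conjugatesOf g = {x : G | ∃ z ∈ commutator G, x = g * z}

/-- The third term `G_3 = [G', G]` of the lower central series `G = G_1 ≥ G' = G_2 ≥ G_3 ≥ ⋯`. -/
def thirdLCS (G : Type*) [Group G] : Subgroup G := ⁅commutator G, (⊤ : Subgroup G)⁆

/-- For a normal subgroup `N`, the subgroup `C(N) ≥ N` determined by
`C(N) / N = C_{G/N}(G' N / N)`, as the preimage in `G` of this centralizer. -/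
def centralizerMod {G : Type*} [Group G] (N : Subgroup G) [N.Normal] : Subgroup G :=
  (Subgroup.centralizer
    ((commutator G).map (QuotientGroup.mk' N) : Set (G ⧸ N))).comap (QuotientGroup.mk' N)

/-- If `G` has nilpotence class `3`, all subgroups of `G_3` are central, hence normal. -/
theorem normal_of_le_thirdLCS {G : Type*} [Group G] (h : Group.nilpotencyClass G = 3)
    {N : Subgroup G} (hN : N ≤ thirdLCS G) : N.Normal := by
  have hG : Group.IsNilpotent G := by
    by_contra hG
    rw [Group.nilpotencyClass_of_not_nilpotent hG] at h
    omega
  have h3 : ⁅thirdLCS G, (⊤ : Subgroup G)⁆ = ⊥ := by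
    have := Subgroup.lowerCentralSeries_nilpotencyClass (G := G)
    rw [h] at this
    exact this
  refine ⟨fun n hn g => ?_⟩
  have hc :=
    Subgroup.commutator_mem_commutator (hN hn) (Subgroup.mem_top g)
  rw [h3, Subgroup.mem_bot, commutatorElement_eq_one_iff_mul_comm] at hc
  rwa [← hc, mul_inv_cancel_right]

/-- `𝒞(G)`, the set of the subgroups `C(N)`, where `N` runs over the subgroups of `G_3` of
index `p` in `G_3`. The normality of `N`, needed to form `G ⧸ N`, is automatic when `G` has
nilpotence class `3`, by `normal_of_le_thirdLCS`. -/
def centralizerFamily (G : Type*) [Group G] (p : ℕ) : Set (Subgroup G) :=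
  {C | ∃ (N : Subgroup G) (_ : N.Normal),
    N ≤ thirdLCS G ∧ N.relIndex (thirdLCS G) = p ∧ C = centralizerMod N}

/-!
Let `V = G / G'` and write `F` for the field with `p` elements. A nonzero homomorphism `φ : G' → F`
that kills `G_3` turns commutators into an alternating form on `V`, nondegenerate because `G` is a
Camina group. The Pfaffian of the generic form in the space `L` of all such `φ` has degree
`dim V / 2`, so by Chevalley–Warning `2 dim L ≤ dim V`: otherwise some nonzero `φ` would have a
degenerate form.

For a nonzero `l : G_3 → F`, the map `z ↦ l ⁅·, z⁆` from `V` to `L` has kernel `C(ker l) / G'`. By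
the Hall–Witt identity this kernel is isotropic for each form `(x, y) ↦ l ⁅⁅y, x⁆, z⁆`, so its
dimension is at most, and by the bound on `dim L` at least, half of `dim V`. As the subgroups `C(N)`
thus all have the same order, the homomorphisms `l` with a given `C(ker l)` form, together with
zero, a subgroup of the dual of `G_3`; these subgroups partition it, and `C_G(G') ≤ G'` makes them
proper. A group partitioned into `s + 1` proper subgroups has order at most `s ^ 2`: a coset of one
part `U`, other than `U`, meets each other part at most once and never meets `U`, whence `|U| ≤ s`.
-/

section AlternatingMatrix

open Matrix Finset

variable {ι κ R S F : Type*}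

/-- A matrix is alternating if it is the Gram matrix of an alternating bilinear form: it is
skew-symmetric, and its diagonal vanishes, which is a separate condition in characteristic two. -/
structure IsAlternatingMatrix [AddGroup R] (A : Matrix ι ι R) : Prop where
  transpose_eq_neg : Aᵀ = -A
  apply_self (i : ι) : A i i = 0

namespace IsAlternatingMatrix

theorem apply_swap [AddGroup R] {A : Matrix ι ι R} (hA : IsAlternatingMatrix A) (i j : ι) :
    A j i = -A i j :=
  congrFun (congrFun hA.transpose_eq_neg i) j

theorem submatrix [AddGroup R] {A : Matrix ι ι R} (hA : IsAlternatingMatrix A) (e : κ → ι) :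
    IsAlternatingMatrix (A.submatrix e e) :=
  ⟨by rw [transpose_submatrix, hA.transpose_eq_neg]; rfl, fun i => hA.apply_self (e i)⟩

theorem map [AddGroup R] [AddGroup S] {A : Matrix ι ι R} (hA : IsAlternatingMatrix A)
    (f : R →+ S) : IsAlternatingMatrix (A.map f) where
  transpose_eq_neg := by ext i j; simp [hA.apply_swap i j]
  apply_self i := by rw [map_apply, hA.apply_self, map_zero]

theorem sum [AddCommGroup R] {s : Finset κ} {A : κ → Matrix ι ι R}
    (hA : ∀ k ∈ s, IsAlternatingMatrix (A k)) : IsAlternatingMatrix (∑ k ∈ s, A k) where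
  transpose_eq_neg := by
    rw [transpose_sum, ← sum_neg_distrib]
    exact sum_congr rfl fun k hk => (hA k hk).transpose_eq_neg
  apply_self i := by
    rw [Matrix.sum_apply]
    exact sum_eq_zero fun k hk => (hA k hk).apply_self i

end IsAlternatingMatrix

theorem isAlternatingMatrix_iff_dotProduct_mulVec [Fintype ι] [CommRing R]
    {A : Matrix ι ι R} : IsAlternatingMatrix A ↔ ∀ v, v ⬝ᵥ A *ᵥ v = 0 := by
  classical
  refine ⟨fun hA v => ?_, fun h => ?_⟩
  · simp only [dotProduct, mulVec, mul_sum]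
    rw [← Fintype.sum_prod_type' fun i j => v i * (A i j * v j)]
    refine sum_involution (fun x _ => x.swap) (fun x _ => ?_) (fun x _ hx hswap => hx ?_)
      (fun _ _ => mem_univ _) fun x _ => x.swap_swap
    · simp only [Prod.fst_swap, Prod.snd_swap, hA.apply_swap x.1 x.2]
      ring
    · rw [congrArg Prod.fst hswap.symm, Prod.fst_swap, hA.apply_self, zero_mul, mul_zero]
  · have hdiag (i : ι) : A i i = 0 := by simpa using h (Pi.single i 1)
    refine ⟨?_, hdiag⟩
    ext i j
    have := h (Pi.single i 1 + Pi.single j 1)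
    simpa [mulVec_add, hdiag, add_eq_zero_iff_eq_neg] using this

theorem IsAlternatingMatrix.schur_complement [Fintype ι] [DecidableEq ι] [Finite κ] [CommRing R]
    {P : Matrix ι ι R} {Q : Matrix ι κ R} {U : Matrix κ ι R} {S : Matrix κ κ R} [Invertible P]
    (hA : IsAlternatingMatrix (fromBlocks P Q U S)) : IsAlternatingMatrix (S - U * ⅟P * Q) := by
  have := Fintype.ofFinite κ
  rw [isAlternatingMatrix_iff_dotProduct_mulVec] at hA ⊢
  intro v
  have h := hA (Sum.elim (-(⅟P * Q) *ᵥ v) v)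
  simpa [fromBlocks_mulVec, neg_mulVec, mulVec_neg, ← Matrix.mul_assoc, sub_mulVec,
    sumElim_dotProduct_sumElim, neg_add_eq_sub] using h

theorem IsAlternatingMatrix.exists_det_eq_sq_mul_det [Fintype κ] [DecidableEq κ] [Field F]
    {A : Matrix (Fin 2 ⊕ κ) (Fin 2 ⊕ κ) F} (hA : IsAlternatingMatrix A)
    (h : A (.inl 0) (.inl 1) ≠ 0) :
    ∃ D : Matrix κ κ F, IsAlternatingMatrix D ∧ A.det = A (.inl 0) (.inl 1) ^ 2 * D.det := by
  have hdet : A.toBlocks₁₁.det = A (.inl 0) (.inl 1) ^ 2 := by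
    simp [det_fin_two, toBlocks₁₁, hA.apply_self, hA.apply_swap (.inl 0) (.inl 1), sq]
  have := A.toBlocks₁₁.invertibleOfIsUnitDet (hdet ▸ (pow_ne_zero 2 h).isUnit)
  rw [← fromBlocks_toBlocks A] at hA
  refine ⟨_, hA.schur_complement, ?_⟩
  rw [← hdet, ← det_fromBlocks₁₁, fromBlocks_toBlocks]

theorem IsAlternatingMatrix.isSquare_det_fin [Field F] {n : ℕ} {A : Matrix (Fin n) (Fin n) F}
    (hA : IsAlternatingMatrix A) : IsSquare A.det := by
  induction n using Nat.twoStepInduction with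
  | zero => exact ⟨1, by simp⟩
  | one => exact ⟨0, by simp [hA.apply_self]⟩
  | more n ih _ =>
    let e₀ : Fin 2 ⊕ Fin n ≃ Fin (n + 2) := finSumFinEquiv.trans (finCongr (add_comm 2 n))
    by_cases hrow : ∀ j, A (e₀ (.inl 0)) j = 0
    · rw [det_eq_zero_of_row_eq_zero _ hrow]
      exact IsSquare.zero
    push Not at hrow
    obtain ⟨j, hj⟩ := hrow
    let e := e₀.trans (Equiv.swap (e₀ (.inl 1)) j)
    have he₀ : e (.inl 0) = e₀ (.inl 0) := by
      rw [Equiv.trans_apply, Equiv.swap_apply_of_ne_of_ne (e₀.injective.ne (by simp))]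
      exact fun h => hj (h ▸ hA.apply_self _)
    have he₁ : e (.inl 1) = j := by rw [Equiv.trans_apply, Equiv.swap_apply_left]
    obtain ⟨D, hD, hdet⟩ := (hA.submatrix e).exists_det_eq_sq_mul_det (by simpa [he₀, he₁])
    rw [← det_submatrix_equiv_self e, hdet]
    exact (IsSquare.sq _).mul (ih hD)

theorem IsAlternatingMatrix.isSquare_det [Fintype ι] [DecidableEq ι] [CommRing R] [IsDomain R]
    [IsIntegrallyClosed R] {A : Matrix ι ι R} (hA : IsAlternatingMatrix A) : IsSquare A.det := by
  let g := algebraMap R (FractionRing R)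
  let e := (Fintype.equivFin ι).symm
  obtain ⟨r, hr⟩ := ((hA.map g.toAddMonoidHom).submatrix e).isSquare_det_fin
  have hgr : g A.det = r ^ 2 := by
    rw [sq, ← hr, det_submatrix_equiv_self, RingHom.map_det]
    rfl
  obtain ⟨f, hf⟩ := IsIntegrallyClosed.exists_algebraMap_eq_of_isIntegral_pow (R := R)
    two_pos (hgr ▸ isIntegral_algebraMap)
  refine ⟨f, IsFractionRing.injective R (FractionRing R) ?_⟩
  rw [map_mul, hf, ← sq]
  exact hgr

theorem totalDegree_det_le {σ : Type*} [Fintype ι] [DecidableEq ι] [CommRing R]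
    {A : Matrix ι ι (MvPolynomial σ R)} {d : ℕ} (h : ∀ i j, (A i j).totalDegree ≤ d) :
    A.det.totalDegree ≤ Fintype.card ι * d := by
  rw [det_apply]
  refine MvPolynomial.totalDegree_finsetSum_le fun τ _ => ?_
  calc _ ≤ (∏ i, A (τ i) i).totalDegree := MvPolynomial.totalDegree_smul_le _ _
    _ ≤ ∑ i, (A (τ i) i).totalDegree := MvPolynomial.totalDegree_finsetProd _ _
    _ ≤ ∑ _i : ι, d := sum_le_sum fun i _ => h (τ i) i
    _ = Fintype.card ι * d := by simp

/-- The matrix `∑ k, X k • A k` of linear forms in one indeterminate per member of a family of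
matrices, whose specializations are the linear combinations of the family. -/
noncomputable def genericCombination [CommSemiring R] [Fintype κ] (A : κ → Matrix ι ι R) :
    Matrix ι ι (MvPolynomial κ R) :=
  ∑ k, (A k).map fun a => MvPolynomial.monomial (Finsupp.single k 1) a

theorem eval_genericCombination [CommSemiring R] [Fintype κ] (A : κ → Matrix ι ι R) (t : κ → R) :
    (genericCombination A).map (MvPolynomial.eval t) = ∑ k, t k • A k := by
  ext i j
  simp [genericCombination, Matrix.sum_apply, MvPolynomial.eval_monomial, mul_comm]

theorem totalDegree_genericCombination_le [CommSemiring R] [Fintype κ] (A : κ → Matrix ι ι R)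
    (i j : ι) : (genericCombination A i j).totalDegree ≤ 1 := by
  rw [genericCombination, Matrix.sum_apply]
  refine MvPolynomial.totalDegree_finsetSum_le fun k _ => ?_
  exact (MvPolynomial.totalDegree_monomial_le _ _).trans (by simp)

theorem isSquare_det_genericCombination [Field F] [Fintype κ] [Fintype ι] [DecidableEq ι]
    {A : κ → Matrix ι ι F} (hA : ∀ k, IsAlternatingMatrix (A k)) :
    IsSquare (genericCombination A).det :=
  IsAlternatingMatrix.isSquare_det <| IsAlternatingMatrix.sum fun k _ =>
    (hA k).map (MvPolynomial.monomial (R := F) (Finsupp.single k 1)).toAddMonoidHom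

theorem exists_ne_zero_eval_eq_zero [Field F] [Finite F] [Fintype κ] {f : MvPolynomial κ F}
    (hdeg : f.totalDegree < Fintype.card κ) (h0 : f.eval 0 = 0) :
    ∃ t : κ → F, t ≠ 0 ∧ f.eval t = 0 := by
  classical
  have := Fintype.ofFinite F
  obtain ⟨p, hp⟩ := CharP.exists F
  have hpp : p.Prime := (CharP.char_is_prime_or_zero F p).resolve_right
    (CharP.char_ne_zero_of_finite F p)
  have hone : 1 < Fintype.card {t // f.eval t = 0} := hpp.one_lt.trans_le <|
    Nat.le_of_dvd (Fintype.card_pos_iff.2 ⟨⟨0, h0⟩⟩) (char_dvd_card_solutions p hdeg)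
  obtain ⟨⟨t, ht⟩, hne⟩ := Fintype.exists_ne_of_one_lt_card hone ⟨0, h0⟩
  exact ⟨t, fun h => hne (Subtype.ext h), ht⟩

theorem exists_ne_zero_det_sum_smul_eq_zero [Field F] [Finite F] [Fintype κ] [Fintype ι]
    [DecidableEq ι] [Nonempty ι] {A : κ → Matrix ι ι F} (hA : ∀ k, IsAlternatingMatrix (A k))
    (hcard : Fintype.card ι < 2 * Fintype.card κ) :
    ∃ t : κ → F, t ≠ 0 ∧ (∑ k, t k • A k).det = 0 := by
  obtain ⟨f, hf⟩ := isSquare_det_genericCombination hA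
  have heval (t : κ → F) : (∑ k, t k • A k).det = f.eval t * f.eval t := by
    rw [← eval_genericCombination, ← map_mul, ← hf, RingHom.map_det]
    rfl
  have hdeg : f.totalDegree < Fintype.card κ := by
    have h := totalDegree_det_le (totalDegree_genericCombination_le A)
    by_cases h0 : f = 0
    · simpa [h0] using Nat.pos_of_mul_pos_left (Nat.zero_lt_of_lt hcard)
    · rw [hf, MvPolynomial.totalDegree_mul_of_isDomain h0 h0] at h
      lia
  have h0 : f.eval 0 = 0 := by simpa using (heval 0).symm
  obtain ⟨t, ht, hft⟩ := exists_ne_zero_eval_eq_zero hdeg h0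
  exact ⟨t, ht, by rw [heval, hft, zero_mul]⟩

end AlternatingMatrix

section BilinForm

open Module

theorem isAlternatingMatrix_toMatrix {ι R M : Type*} [Fintype ι] [DecidableEq ι] [CommRing R]
    [AddCommGroup M] [Module R M] (b : Basis ι R M) {B : LinearMap.BilinForm R M} (hB : B.IsAlt) :
    IsAlternatingMatrix (LinearMap.BilinForm.toMatrix b B) where
  transpose_eq_neg := by
    ext i j
    rw [Matrix.transpose_apply, Matrix.neg_apply, LinearMap.BilinForm.toMatrix_apply,
      LinearMap.BilinForm.toMatrix_apply, hB.neg_eq]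
  apply_self i := by rw [LinearMap.BilinForm.toMatrix_apply, hB.self_eq_zero]

theorem two_mul_finrank_le_of_isAlt_of_nondegenerate {F V L : Type*} [Field F] [Finite F]
    [AddCommGroup V] [Module F V] [FiniteDimensional F V] [Nontrivial V]
    [AddCommGroup L] [Module F L] [FiniteDimensional F L] {B : L →ₗ[F] LinearMap.BilinForm F V}
    (halt : ∀ φ, (B φ).IsAlt) (hnd : ∀ φ ≠ 0, (B φ).Nondegenerate) :
    2 * finrank F L ≤ finrank F V := by
  by_contra! hlt
  let b := finBasis F V
  let c := finBasis F L
  have : Nonempty (Fin (finrank F V)) := ⟨0, finrank_pos⟩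
  obtain ⟨t, ht, hdet⟩ := exists_ne_zero_det_sum_smul_eq_zero
    (fun k => isAlternatingMatrix_toMatrix b (halt (c k))) (by simpa using hlt)
  have hφ : c.equivFun.symm t ≠ 0 := (LinearEquiv.map_ne_zero_iff _).2 ht
  refine (LinearMap.BilinForm.nondegenerate_iff_det_ne_zero b).1 (hnd _ hφ) ?_
  simpa [Basis.equivFun_symm_apply] using hdet

end BilinForm

section Partition

open Finset

theorem card_add_one_le_card_of_partition {A : Type*} [AddGroup A] {P : Finset (AddSubgroup A)}
    (hdisj : (P : Set (AddSubgroup A)).PairwiseDisjoint id)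
    (hcover : ∀ x : A, x ≠ 0 → ∃ W ∈ P, x ∈ W) {U : AddSubgroup A} (hU : U ∈ P) (hU' : U ≠ ⊤) :
    Nat.card U + 1 ≤ #P := by
  classical
  obtain ⟨y, hy⟩ : ∃ y, y ∉ U := by simpa [AddSubgroup.eq_top_iff'] using hU'
  have hyx (x : U) : y + x ∉ U := fun h => hy ((U.add_mem_cancel_right x.2).1 h)
  have hmem (x : U) : ∃ W ∈ P, y + x ∈ W :=
    hcover _ (ne_of_mem_of_not_mem U.zero_mem (hyx x)).symm
  choose W hWP hW using hmem
  -- Two points of `y + U` in the same part `W` differ by an element of `U ⊓ W`.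
  have hWU (x : U) : W x ≠ U := fun h => hyx x (h.le (hW x))
  have hinj : Function.Injective fun x => (⟨W x, mem_erase.2 ⟨hWU x, hWP x⟩⟩ : P.erase U) := by
    intro x x' h
    have hxx' : W x = W x' := congrArg Subtype.val h
    have hmem : -(x : A) + x' ∈ W x := by
      have := (W x).add_mem ((W x).neg_mem (hW x)) (hxx' ▸ hW x')
      rwa [neg_add_rev, add_assoc, neg_add_cancel_left] at this
    have h0 := AddSubgroup.disjoint_def.1 (hdisj (hWP x) hU (hWU x)) hmem
      (U.add_mem (U.neg_mem x.2) x'.2)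
    exact Subtype.ext (neg_add_eq_zero.1 h0)
  calc Nat.card U + 1 ≤ #(P.erase U) + 1 := by
        rw [← Nat.card_eq_finsetCard]
        exact Nat.add_le_add_right (Nat.card_le_card_of_injective _ hinj) 1
    _ = #P := card_erase_add_one hU

theorem card_le_sq_of_partition {A : Type*} [AddGroup A] [Finite A] [Nontrivial A]
    {P : Finset (AddSubgroup A)} (hdisj : (P : Set (AddSubgroup A)).PairwiseDisjoint id)
    (hcover : ∀ x : A, x ≠ 0 → ∃ U ∈ P, x ∈ U) (htop : ⊤ ∉ P) :
    Nat.card A ≤ (#P - 1) ^ 2 := by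
  classical
  have := Fintype.ofFinite A
  have hcard : ∀ U ∈ P, Nat.card U + 1 ≤ #P := fun U hU =>
    card_add_one_le_card_of_partition hdisj hcover hU fun h => htop (h ▸ hU)
  obtain ⟨x, hx⟩ := exists_ne (0 : A)
  obtain ⟨s, hs⟩ : ∃ s, #P = s + 2 := by
    obtain ⟨U, hU, -⟩ := hcover x hx
    exact Nat.exists_eq_add_of_le' ((Nat.succ_le_succ Nat.card_pos).trans (hcard U hU))
  have hcount : #(univ.erase (0 : A)) ≤ #P * s := by
    refine (card_le_card fun y hy => ?_).trans (card_biUnion_le_card_mul P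
      (fun U => {y ∈ univ.erase (0 : A) | y ∈ U}) s fun U hU => ?_)
    · obtain ⟨U, hU, hyU⟩ := hcover y (ne_of_mem_erase hy)
      exact mem_biUnion.2 ⟨U, hU, mem_filter.2 ⟨hy, hyU⟩⟩
    · have hUs : Nat.card U ≤ s + 1 := by have := hcard U hU; lia
      rw [filter_erase, card_erase_of_mem (by simp), ← Fintype.card_subtype,
        ← Nat.card_eq_fintype_card]
      exact Nat.sub_le_of_le_add hUs
  rw [card_erase_of_mem (mem_univ _), card_univ, ← Nat.card_eq_fintype_card, hs] at hcount
  rw [hs, Nat.add_sub_cancel (m := 1)]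
  have : (s + 1) ^ 2 = (s + 2) * s + 1 := by ring
  grind

end Partition

section ClassThree

open Module Finset

variable {F V L K : Type*} [Field F] [AddCommGroup V] [Module F V]
  [AddCommGroup L] [Module F L] [AddCommGroup K] [Module F K]

theorem two_mul_finrank_le_of_isotropic [FiniteDimensional F V]
    {B : LinearMap.BilinForm F V} (hB : B.Nondegenerate) {W : Submodule F V}
    (hW : ∀ x ∈ W, ∀ y ∈ W, B x y = 0) : 2 * finrank F W ≤ finrank F V := by
  have h := Submodule.finrank_mono fun y hy => LinearMap.BilinForm.mem_orthogonal_iff.2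
    fun x hx => hW x hx y hy
  rw [LinearMap.BilinForm.finrank_orthogonal hB] at h
  have := W.finrank_le
  lia

theorem isotropic_ker_of_jacobi {B : L →ₗ[F] LinearMap.BilinForm F V} {T : K →ₗ[F] V →ₗ[F] L}
    (hJ : ∀ l x y z, B (T l z) x y + B (T l x) y z + B (T l y) z x = 0) (l : K) (z : V) :
    ∀ x ∈ LinearMap.ker (T l), ∀ y ∈ LinearMap.ker (T l), B (T l z) x y = 0 := by
  intro x hx y hy
  simpa [LinearMap.mem_ker.1 hx, LinearMap.mem_ker.1 hy] using hJ l x y z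

theorem two_mul_finrank_ker_eq [Finite F] [FiniteDimensional F V] [FiniteDimensional F L]
    {B : L →ₗ[F] LinearMap.BilinForm F V}
    (halt : ∀ φ, (B φ).IsAlt) (hnd : ∀ φ ≠ 0, (B φ).Nondegenerate) {T : K →ₗ[F] V →ₗ[F] L}
    (hJ : ∀ l x y z, B (T l z) x y + B (T l x) y z + B (T l y) z x = 0) {l : K} (hl : T l ≠ 0) :
    2 * finrank F (LinearMap.ker (T l)) = finrank F V := by
  obtain ⟨z, hz⟩ : ∃ z, T l z ≠ 0 := by simpa [LinearMap.ext_iff] using hl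
  have : Nontrivial V := ⟨z, 0, fun h => hz (by rw [h, map_zero])⟩
  have hker := two_mul_finrank_le_of_isotropic (hnd _ hz) (isotropic_ker_of_jacobi hJ l z)
  have hL := two_mul_finrank_le_of_isAlt_of_nondegenerate halt hnd
  have hrank := (T l).finrank_range_add_finrank_ker
  have hrange := (LinearMap.range (T l)).finrank_le
  lia

theorem natCard_le_sq_of_finrank_ker_eq [FiniteDimensional F V] [Finite K] [Nontrivial K]
    {T : K →ₗ[F] V →ₗ[F] L} {d : ℕ} (hd : d ≠ 0)
    (hker : ∀ l ≠ 0, finrank F (LinearMap.ker (T l)) = d)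
    (hT : ∀ x, (∀ l, T l x = 0) → x = 0) :
    Nat.card K ≤ ({C | ∃ l ≠ 0, LinearMap.ker (T l) = C}.ncard - 1) ^ 2 := by
  classical
  set S := {C | ∃ l ≠ 0, LinearMap.ker (T l) = C}
  have hS : S.Finite := (Set.finite_range fun l => LinearMap.ker (T l)).subset <| by
    rintro _ ⟨l, -, rfl⟩
    exact ⟨l, rfl⟩
  have hmax : ∀ C ∈ S, ∀ m ≠ 0, C ≤ LinearMap.ker (T m) → C = LinearMap.ker (T m) := by
    rintro _ ⟨l, hl, rfl⟩ m hm hle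
    exact Submodule.eq_of_le_of_finrank_eq hle ((hker l hl).trans (hker m hm).symm)
  let part (C : Submodule F V) : AddSubgroup K := ((C.compatibleMaps ⊥).comap T).toAddSubgroup
  have hmem {C : Submodule F V} {m : K} : m ∈ part C ↔ C ≤ LinearMap.ker (T m) := Iff.rfl
  have hcard := card_le_sq_of_partition (P := hS.toFinset.image part) ?_ ?_ ?_
  · refine hcard.trans (Nat.pow_le_pow_left (Nat.sub_le_sub_right ?_ 1) 2)
    exact Finset.card_image_le.trans_eq (Set.ncard_eq_toFinset_card S hS).symm
  · simp only [coe_image, Set.Finite.coe_toFinset]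
    rintro _ ⟨C, hC, rfl⟩ _ ⟨D, hD, rfl⟩ hCD
    refine AddSubgroup.disjoint_def.2 fun {m} hmC hmD => by_contra fun hm => hCD ?_
    rw [hmax C hC m hm hmC, ← hmax D hD m hm hmD]
  · exact fun l hl => ⟨_, mem_image_of_mem part (hS.mem_toFinset.2 ⟨l, hl, rfl⟩), hmem.2 le_rfl⟩
  · simp only [mem_image, Set.Finite.mem_toFinset]
    rintro ⟨_, ⟨l, hl, rfl⟩, htop⟩
    have hbot : LinearMap.ker (T l) = ⊥ := (Submodule.eq_bot_iff _).2 fun x hx =>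
      hT x fun m => hmem.1 (htop ▸ AddSubgroup.mem_top m) hx
    exact hd (by rw [← hker l hl, hbot, finrank_bot])

theorem natCard_le_sq_of_jacobi [Finite F] [FiniteDimensional F V] [FiniteDimensional F L]
    [Finite K] [Nontrivial K] {B : L →ₗ[F] LinearMap.BilinForm F V}
    (halt : ∀ φ, (B φ).IsAlt) (hnd : ∀ φ ≠ 0, (B φ).Nondegenerate) {T : K →ₗ[F] V →ₗ[F] L}
    (hJ : ∀ l x y z, B (T l z) x y + B (T l x) y z + B (T l y) z x = 0)
    (hinj : Function.Injective T) (hT : ∀ x, (∀ l, T l x = 0) → x = 0) :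
    Nat.card K ≤ ({C | ∃ l ≠ 0, LinearMap.ker (T l) = C}.ncard - 1) ^ 2 := by
  have hker (l : K) (hl : l ≠ 0) : 2 * finrank F (LinearMap.ker (T l)) = finrank F V :=
    two_mul_finrank_ker_eq halt hnd hJ ((map_ne_zero_iff T hinj).2 hl)
  have : Nontrivial V := (subsingleton_or_nontrivial V).resolve_left fun _ =>
    not_subsingleton K ⟨fun l m => hinj (Subsingleton.elim _ _)⟩
  obtain ⟨l, hl⟩ := exists_ne (0 : K)
  have hpos : 0 < finrank F V := finrank_pos
  refine natCard_le_sq_of_finrank_ker_eq (d := finrank F (LinearMap.ker (T l))) ?_ ?_ hT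
  · have := hker l hl
    lia
  · intro m hm
    have := hker l hl
    have := hker m hm
    lia

end ClassThree

section InvariantHoms

open scoped commutatorElement

variable (R : Type*) {G : Type*} (A : Type*) [Group G] [CommRing R] [AddCommGroup A] [Module R A]

/-- The homomorphisms from a subgroup `H` to an abelian group `A` that kill `[H, G]`. If `H` is
normal, these are the homomorphisms invariant under conjugation, that is, the homomorphisms from
`H / [H, G]` to `A`. -/
def invariantHoms (H : Subgroup G) : Submodule R (Additive H →+ A) where
  carrier := {f | ∀ h : H, (h : G) ∈ ⁅H, (⊤ : Subgroup G)⁆ → f (.ofMul h) = 0}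
  add_mem' hf hf' h hh := by rw [AddMonoidHom.add_apply, hf h hh, hf' h hh, add_zero]
  zero_mem' _ _ := rfl
  smul_mem' r f hf h hh := by rw [AddMonoidHom.smul_apply, hf h hh, smul_zero]

variable {R A} {H : Subgroup G}

instance invariantHoms_finite [Finite A] [Finite H] : Finite (invariantHoms R A H) :=
  have : Finite (Additive H →+ A) := DFunLike.finite _
  inferInstance

theorem invariantHoms_conj_apply [H.Normal] (f : invariantHoms R A H) (x : G) (h : H)
    (hx : x * h * x⁻¹ ∈ H) : f.1 (.ofMul ⟨x * h * x⁻¹, hx⟩) = f.1 (.ofMul h) := by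
  have hmem : ⁅x, (h : G)⁆ ∈ ⁅H, (⊤ : Subgroup G)⁆ := by
    rw [Subgroup.commutator_comm]
    exact Subgroup.commutator_mem_commutator (Subgroup.mem_top x) h.2
  have heq : (⟨x * h * x⁻¹, hx⟩ : H) = ⟨⁅x, (h : G)⁆, Subgroup.commutator_le_left H ⊤ hmem⟩ * h :=
    Subtype.ext (by simp [commutatorElement_def])
  rw [heq, ofMul_mul, map_add, f.2 _ hmem, zero_add]

/-- The commutator of an element of `H` and an arbitrary element, as an element of `[H, G]`. -/
def commutatorTop (h : H) (x : G) : ↥⁅H, (⊤ : Subgroup G)⁆ :=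
  ⟨⁅(h : G), x⁆, Subgroup.commutator_mem_commutator h.2 (Subgroup.mem_top x)⟩

variable [H.Normal]

theorem invariantHoms_commutatorTop_mul_left (f : invariantHoms R A ⁅H, (⊤ : Subgroup G)⁆)
    (h k : H) (x : G) : f.1 (.ofMul (commutatorTop (h * k) x)) =
      f.1 (.ofMul (commutatorTop h x)) + f.1 (.ofMul (commutatorTop k x)) := by
  have hmem := Subgroup.Normal.conj_mem inferInstance _ (commutatorTop k x).2 (h : G)
  have heq : commutatorTop (h * k) x = ⟨_, hmem⟩ * commutatorTop h x :=
    Subtype.ext (commutatorElement_mul_left_eq_conj_mul (h : G) k x)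
  rw [heq, ofMul_mul, map_add, invariantHoms_conj_apply, add_comm]

theorem invariantHoms_commutatorTop_mul_right (f : invariantHoms R A ⁅H, (⊤ : Subgroup G)⁆)
    (h : H) (x y : G) : f.1 (.ofMul (commutatorTop h (x * y))) =
      f.1 (.ofMul (commutatorTop h x)) + f.1 (.ofMul (commutatorTop h y)) := by
  have hmem := Subgroup.Normal.conj_mem inferInstance _ (commutatorTop h y).2 x
  have heq : commutatorTop h (x * y) = commutatorTop h x * ⟨_, hmem⟩ :=
    Subtype.ext <| (commutatorElement_mul_right_eq_mul_conj (h : G) x y).trans <| by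
      simp only [mul_assoc, commutatorTop, Subgroup.coe_mul]
  rw [heq, ofMul_mul, map_add, invariantHoms_conj_apply]

variable (R A H)

/-- The map sending `f : [H, G] → A` and `x : G` to the homomorphism `h ↦ f ⁅h, x⁆` on `H`. -/
def coad : invariantHoms R A ⁅H, (⊤ : Subgroup G)⁆ →ₗ[R] Additive G →+ invariantHoms R A H where
  toFun f := AddMonoidHom.mk' (fun x =>
      ⟨AddMonoidHom.mk' (fun h => f.1 (.ofMul (commutatorTop h.toMul x.toMul)))
        fun h k => invariantHoms_commutatorTop_mul_left f h.toMul k.toMul x.toMul,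
        fun _ hh => f.2 _ (Subgroup.commutator_mem_commutator hh (Subgroup.mem_top _))⟩)
    fun x y => Subtype.ext <| AddMonoidHom.ext fun h =>
      invariantHoms_commutatorTop_mul_right f h.toMul x.toMul y.toMul
  map_add' _ _ := rfl
  map_smul' _ _ := rfl

variable {R H A}

theorem coad_injective : Function.Injective (coad R A H) := by
  refine (injective_iff_map_eq_zero _).2 fun f hf => Subtype.ext <| AddMonoidHom.ext fun z => ?_
  have hle : ⁅H, (⊤ : Subgroup G)⁆ ≤
      (AddMonoidHom.toMultiplicativeRight f.1).ker.map ⁅H, (⊤ : Subgroup G)⁆.subtype := by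
    refine Subgroup.commutator_le.2 fun h hh x _ => ⟨commutatorTop ⟨h, hh⟩ x, ?_, rfl⟩
    exact congrArg (fun g => (g (.ofMul x)).1 (.ofMul ⟨h, hh⟩)) hf
  obtain ⟨z', hz', heq⟩ := hle z.toMul.2
  rwa [Subtype.ext heq] at hz'

end InvariantHoms

section CommutatorForms

open scoped commutatorElement

variable (R : Type*) {G : Type*} (A : Type*) [Group G] [CommRing R] [AddCommGroup A] [Module R A]

/-- The map sending `φ : G' → A` to the form `(x, y) ↦ φ ⁅y, x⁆` on `G`. -/
def commutatorForm :
    invariantHoms R A (commutator G) →ₗ[R] Additive G →+ Additive G →+ A where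
  toFun φ := (AddMonoidHom.compHom' (MonoidHom.toAdditive Subgroup.topEquiv.symm.toMonoidHom)).comp
    ((invariantHoms R A (⊤ : Subgroup G)).subtype.toAddMonoidHom.comp (coad R A ⊤ φ))
  map_add' _ _ := rfl
  map_smul' _ _ := rfl

/-- The map sending `f : G_3 → A` and `x : G` to the homomorphism `w ↦ f ⁅w, x⁆` on `G'`. -/
def thirdCoad :
    invariantHoms R A (thirdLCS G) →ₗ[R] Additive G →+ invariantHoms R A (commutator G) :=
  coad R A (commutator G)

/-- The commutator of two elements of `G`, as an element of `G'`. -/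
def commutatorMk (x y : G) : commutator G :=
  ⟨⁅x, y⁆, Subgroup.commutator_mem_commutator (Subgroup.mem_top x) (Subgroup.mem_top y)⟩

/-- The commutator of an element of `G'` and an element of `G`, as an element of `G_3`. -/
def thirdCommutator (w : commutator G) (x : G) : thirdLCS G := commutatorTop w x

variable {R A}

theorem commutatorForm_self (φ : invariantHoms R A (commutator G)) (x : Additive G) :
    commutatorForm R A φ x x = 0 :=
  (congrArg (fun w => φ.1 (.ofMul w)) (Subtype.ext (commutatorElement_self x.toMul))).trans
    (map_zero φ.1)

theorem commutatorForm_injective : Function.Injective (commutatorForm R A (G := G)) :=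
  (injective_iff_map_eq_zero _).2 fun _ hφ =>
    (injective_iff_map_eq_zero (coad R A (⊤ : Subgroup G))).1 coad_injective _ <|
      AddMonoidHom.ext fun x => Subtype.ext <| AddMonoidHom.ext fun y =>
        DFunLike.congr_fun (DFunLike.congr_fun hφ x) (.ofMul (y.toMul : G))

theorem thirdCoad_injective : Function.Injective (thirdCoad R A (G := G)) := coad_injective

theorem commutatorForm_thirdCoad_cyclic (f : invariantHoms R A (thirdLCS G)) (x y z : Additive G) :
    commutatorForm R A (thirdCoad R A f z) x y + commutatorForm R A (thirdCoad R A f x) y z +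
      commutatorForm R A (thirdCoad R A f y) z x = 0 := by
  have hconj (b c : Additive G) : thirdCoad R A f (b + c + -b) = thirdCoad R A f c := by
    rw [map_add, map_add, map_neg, add_neg_cancel_comm]
  have hallWitt : thirdCommutator (commutatorMk y.toMul x.toMul) (x + z + -x).toMul *
      thirdCommutator (commutatorMk x.toMul z.toMul) (z + y + -z).toMul *
        thirdCommutator (commutatorMk z.toMul y.toMul) (y + x + -y).toMul = 1 :=
    Subtype.ext (commutatorElement_commutatorElement_conj_mul y.toMul x.toMul z.toMul)
  have hsum := (congrArg (fun w => f.1 (.ofMul w)) hallWitt).trans f.1.map_zero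
  simp only [ofMul_mul, f.1.map_add] at hsum
  rw [← hconj x z, ← hconj z y, ← hconj y x, add_right_comm]
  exact hsum

theorem IsCaminaGroup.mem_commutator_of_commutatorForm_eq_zero (hG : IsCaminaGroup G)
    {φ : invariantHoms R A (commutator G)} (hφ : φ ≠ 0) {x : G}
    (hx : commutatorForm R A φ (.ofMul x) = 0) : x ∈ commutator G := by
  by_contra hmem
  refine hφ (Subtype.ext <| AddMonoidHom.ext fun z => ?_)
  obtain ⟨y, hy⟩ := isConj_iff.1 (show IsConj x (x * z.toMul) from
    (hG x hmem).ge ⟨z.toMul, z.toMul.2, rfl⟩)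
  have hconj : x * z.toMul * x⁻¹ = commutatorMk y x := by
    rw [← hy]; rfl
  calc φ.1 z = φ.1 (.ofMul ⟨x * z.toMul * x⁻¹, hconj ▸ Subtype.prop _⟩) :=
        (invariantHoms_conj_apply φ x z.toMul _).symm
    _ = commutatorForm R A φ (.ofMul x) (.ofMul y) :=
        congrArg (fun w => φ.1 (.ofMul w)) (Subtype.ext hconj)
    _ = 0 := DFunLike.congr_fun hx _

end CommutatorForms

section Exponent

open scoped IsMulCommutative

variable {G : Type*} [Group G]

theorem mem_invariantHoms_of_le_center {R A : Type*} [CommRing R] [AddCommGroup A] [Module R A]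
    {H : Subgroup G} (hH : H ≤ Subgroup.center G) (f : Additive H →+ A) :
    f ∈ invariantHoms R A H := fun h hh => by
  rw [Subgroup.commutator_top_right_eq_bot_iff_le_center.2 hH, Subgroup.mem_bot] at hh
  exact (congrArg (fun z => f (.ofMul z)) (Subtype.ext hh)).trans (map_zero f)

/-- The inclusion of a central subgroup `H` into the centre, as an invariant homomorphism. -/
def centerInclusion {H : Subgroup G} (hH : H ≤ Subgroup.center G) :
    invariantHoms ℤ (Additive (Subgroup.center G)) H :=
  ⟨MonoidHom.toAdditive (Subgroup.inclusion hH), mem_invariantHoms_of_le_center hH _⟩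

theorem smul_centerInclusion_eq_zero_iff {H : Subgroup G} (hH : H ≤ Subgroup.center G) {n : ℕ} :
    n • centerInclusion hH = 0 ↔ ∀ z ∈ H, z ^ n = 1 := by
  refine ⟨fun h z hz => ?_, fun h => Subtype.ext <| AddMonoidHom.ext fun z => ?_⟩
  · exact congrArg (fun f => ((f.1 (.ofMul ⟨z, hz⟩)).toMul : G)) h
  · exact congrArg Additive.ofMul (Subtype.ext (h _ z.toMul.2))

theorem exists_invariantHoms_ne_zero_smul_eq_zero [Finite G] {p : ℕ} (hp : p.Prime)
    (hpG : IsPGroup p G) {H : Subgroup G} (hH : H ≤ Subgroup.center G) (hne : H ≠ ⊥) :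
    ∃ f : invariantHoms ℤ (Additive (Subgroup.center G)) H, f ≠ 0 ∧ p • f = 0 := by
  have : Fact p.Prime := ⟨hp⟩
  set f := centerInclusion hH
  obtain ⟨n, hn⟩ := IsPGroup.iff_card.1 hpG
  have hdvd : addOrderOf f ∣ p ^ n := addOrderOf_dvd_of_nsmul_eq_zero <|
    (smul_centerInclusion_eq_zero_iff hH).2 fun z _ => hn ▸ pow_card_eq_one'
  obtain ⟨k, -, hk⟩ := (Nat.dvd_prime_pow hp).1 hdvd
  have hk0 : k ≠ 0 := by
    rintro rfl
    have hf : 1 • f = 0 := by rw [← pow_zero p, ← hk, addOrderOf_nsmul_eq_zero]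
    refine hne ((Subgroup.eq_bot_iff_forall H).2 fun z hz => ?_)
    rw [← pow_one z, (smul_centerInclusion_eq_zero_iff hH).1 hf z hz]
  have horder : addOrderOf ((addOrderOf f / p) • f) = p :=
    addOrderOf_nsmul_addOrderOf_sub (hk ▸ pow_ne_zero k hp.ne_zero) (hk ▸ dvd_pow_self p hk0)
  refine ⟨(addOrderOf f / p) • f, fun h => hp.one_lt.ne ?_, ?_⟩
  · rw [← horder, h, addOrderOf_zero]
  · nth_rw 1 [← horder]
    exact addOrderOf_nsmul_eq_zero _

variable {R A : Type*} [CommRing R] [AddCommGroup A] [Module R A]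

theorem IsCaminaGroup.pow_mem_commutator (hG : IsCaminaGroup G)
    {f : invariantHoms R A (thirdLCS G)} (hf : f ≠ 0) {n : ℕ} (hnf : n • f = 0) (x : G) :
    x ^ n ∈ commutator G := by
  obtain ⟨z, hz⟩ : ∃ z, thirdCoad R A f z ≠ 0 :=
    DFunLike.ne_iff.1 ((map_ne_zero_iff _ thirdCoad_injective).2 hf)
  refine hG.mem_commutator_of_commutatorForm_eq_zero hz ?_
  rw [ofMul_pow, map_nsmul, ← AddMonoidHom.nsmul_apply, ← map_nsmul, ← AddMonoidHom.nsmul_apply,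
    ← map_nsmul, hnf]
  simp only [map_zero, AddMonoidHom.zero_apply]

theorem map_ofMul_eq_zero_of_mem_commutator (f : Additive G →+ A) {x : G}
    (hx : x ∈ commutator G) : f (.ofMul x) = 0 :=
  Abelianization.commutator_subset_ker (AddMonoidHom.toMultiplicativeRight f) hx

theorem smul_invariantHoms_commutator_eq_zero {n : ℕ} (hn : ∀ x : G, x ^ n ∈ commutator G)
    (φ : invariantHoms R A (commutator G)) : n • φ = 0 := by
  refine (map_eq_zero_iff _ commutatorForm_injective).1 (AddMonoidHom.ext fun x => ?_)
  rw [map_nsmul, AddMonoidHom.nsmul_apply, ← map_nsmul]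
  exact map_ofMul_eq_zero_of_mem_commutator _ (hn x.toMul)

theorem smul_invariantHoms_thirdLCS_eq_zero {n : ℕ} (hn : ∀ x : G, x ^ n ∈ commutator G)
    (f : invariantHoms R A (thirdLCS G)) : n • f = 0 := by
  refine (map_eq_zero_iff _ thirdCoad_injective).1 (AddMonoidHom.ext fun x => ?_)
  rw [map_nsmul, AddMonoidHom.nsmul_apply, smul_invariantHoms_commutator_eq_zero hn]
  rfl

theorem thirdLCS_pow_eq_one (hz : thirdLCS G ≤ Subgroup.center G) {n : ℕ}
    (hn : ∀ x : G, x ^ n ∈ commutator G) : ∀ z ∈ thirdLCS G, z ^ n = 1 :=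
  (smul_centerInclusion_eq_zero_iff hz).1 (smul_invariantHoms_thirdLCS_eq_zero hn _)

end Exponent

section NilpotencyClassThree

open scoped IsMulCommutative

variable {G : Type*} [Group G]

theorem isNilpotent_of_nilpotencyClass_ne_zero (h : Group.nilpotencyClass G ≠ 0) :
    Group.IsNilpotent G :=
  by_contra fun hG => h (Group.nilpotencyClass_of_not_nilpotent hG)

theorem thirdLCS_le_center (h : Group.nilpotencyClass G = 3) :
    thirdLCS G ≤ Subgroup.center G := by
  have := isNilpotent_of_nilpotencyClass_ne_zero (h.trans_ne three_ne_zero)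
  have hlast := Subgroup.lowerCentralSeries_nilpotencyClass (G := G)
  rw [h] at hlast
  exact Subgroup.commutator_top_right_eq_bot_iff_le_center.1 hlast

theorem thirdLCS_ne_bot (h : Group.nilpotencyClass G = 3) : thirdLCS G ≠ ⊥ := by
  have := isNilpotent_of_nilpotencyClass_ne_zero (h.trans_ne three_ne_zero)
  intro hbot
  have hle : Group.nilpotencyClass G ≤ 2 :=
    Subgroup.lowerCentralSeries_eq_bot_iff_nilpotencyClass_le.1 hbot
  lia

theorem IsCaminaGroup.pow_prime_mem_commutator [Finite G] (hG : IsCaminaGroup G) {p : ℕ}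
    (hp : p.Prime) (hpG : IsPGroup p G) (hclass : Group.nilpotencyClass G = 3) (x : G) :
    x ^ p ∈ commutator G := by
  obtain ⟨f, hf, hpf⟩ := exists_invariantHoms_ne_zero_smul_eq_zero hp hpG
    (thirdLCS_le_center hclass) (thirdLCS_ne_bot hclass)
  exact hG.pow_mem_commutator hf hpf x

end NilpotencyClassThree

section CentralDual

open scoped IsMulCommutative

variable {G : Type*} [Group G] {H : Subgroup G} {p : ℕ}

theorem natCard_invariantHoms_of_le_center [Finite H] (hp : p.Prime)
    (hH : H ≤ Subgroup.center G) (hpow : ∀ z ∈ H, z ^ p = 1) :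
    Nat.card (invariantHoms (ZMod p) (ZMod p) H) = Nat.card H := by
  have : Fact p.Prime := ⟨hp⟩
  have := Subgroup.le_centralizer_iff_isMulCommutative.1 <|
    hH.trans (Subgroup.center_le_centralizer _)
  have : Module (ZMod p) (Additive H) :=
    AddCommGroup.zmodModule fun z => congrArg Additive.ofMul (Subtype.ext (hpow _ z.toMul.2))
  have htop : invariantHoms (ZMod p) (ZMod p) H = ⊤ :=
    eq_top_iff.2 fun f _ => mem_invariantHoms_of_le_center hH f
  calc Nat.card (invariantHoms (ZMod p) (ZMod p) H)
      = Nat.card (Additive H →+ ZMod p) := by rw [htop, Nat.card_congr Submodule.topEquiv.toEquiv]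
    _ = Nat.card (Module.Dual (ZMod p) (Additive H)) :=
        Nat.card_congr (AddMonoidHom.toZModLinearMapEquiv p).toEquiv
    _ = Nat.card (Additive H) := by
        rw [Module.natCard_eq_pow_finrank (K := ZMod p), Subspace.dual_finrank_eq,
          ← Module.natCard_eq_pow_finrank]

theorem exists_invariantHoms_apply_ne_zero_of_le_center (hp : p.Prime)
    (hH : H ≤ Subgroup.center G) (hpow : ∀ z ∈ H, z ^ p = 1) {z : H} (hz : z ≠ 1) :
    ∃ f : invariantHoms (ZMod p) (ZMod p) H, f.1 (.ofMul z) ≠ 0 := by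
  have : Fact p.Prime := ⟨hp⟩
  have := Subgroup.le_centralizer_iff_isMulCommutative.1 <|
    hH.trans (Subgroup.center_le_centralizer _)
  have : Module (ZMod p) (Additive H) :=
    AddCommGroup.zmodModule fun z => congrArg Additive.ofMul (Subtype.ext (hpow _ z.toMul.2))
  obtain ⟨f, hf⟩ : ∃ f : Additive H →ₗ[ZMod p] ZMod p, f (.ofMul z) ≠ 0 :=
    Module.Projective.exists_dual_ne_zero (ZMod p) hz
  exact ⟨⟨f.toAddMonoidHom, mem_invariantHoms_of_le_center hH _⟩, hf⟩

end CentralDual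

section Abelianization

variable (n : ℕ) (G : Type*) [Group G] [Module (ZMod n) (Additive (Abelianization G))]
  (M : Type*) [AddCommGroup M] [Module (ZMod n) M]

/-- A homomorphism from `G` to a `ℤ/n`-module, as a linear map on the abelianization of `G`. -/
def liftAbelianization :
    (Additive G →+ M) →ₗ[ZMod n] Additive (Abelianization G) →ₗ[ZMod n] M where
  toFun f := AddMonoidHom.toZModLinearMap n <| AddMonoidHom.toMultiplicativeRight.symm <|
    Abelianization.lift (AddMonoidHom.toMultiplicativeRight f)
  map_add' f g := LinearMap.ext fun v => by
    obtain ⟨x, rfl⟩ := QuotientGroup.mk_surjective v.toMul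
    rfl
  map_smul' f g := LinearMap.ext fun v => by
    obtain ⟨x, rfl⟩ := QuotientGroup.mk_surjective v.toMul
    rfl

/-- The form `(x, y) ↦ φ ⁅y, x⁆` on `G / G'` attached to `φ : G' → ℤ/n`. -/
def abelianizationForm : invariantHoms (ZMod n) (ZMod n) (commutator G) →ₗ[ZMod n]
    LinearMap.BilinForm (ZMod n) (Additive (Abelianization G)) where
  toFun φ := liftAbelianization n G _ <|
    (liftAbelianization n G (ZMod n)).toAddMonoidHom.comp (commutatorForm (ZMod n) (ZMod n) φ)
  map_add' φ ψ := by rw [map_add, AddMonoidHom.comp_add, map_add]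
  map_smul' r φ := by
    have hcomp : (liftAbelianization n G (ZMod n)).toAddMonoidHom.comp (r • commutatorForm _ _ φ) =
        r • (liftAbelianization n G (ZMod n)).toAddMonoidHom.comp (commutatorForm _ _ φ) :=
      AddMonoidHom.ext fun x =>
        map_smul (liftAbelianization n G (ZMod n)) r (commutatorForm _ _ φ x)
    rw [map_smul, hcomp, map_smul, RingHom.id_apply]

/-- The map `l ↦ (x ↦ (w ↦ l ⁅w, x⁆))` sending homomorphisms `l : G_3 → ℤ/n` to linear maps from
`G / G'` to the homomorphisms `G' → ℤ/n`. -/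
def abelianizationCoad : invariantHoms (ZMod n) (ZMod n) (thirdLCS G) →ₗ[ZMod n]
    Additive (Abelianization G) →ₗ[ZMod n] invariantHoms (ZMod n) (ZMod n) (commutator G) :=
  liftAbelianization n G _ ∘ₗ thirdCoad (ZMod n) (ZMod n)

variable {n G}

theorem forall_additive_abelianization {P : Additive (Abelianization G) → Prop} :
    (∀ v, P v) ↔ ∀ x : G, P (.ofMul (.of x)) :=
  ⟨fun h _ => h _, fun h v => QuotientGroup.induction_on (C := fun q => P (.ofMul q)) v.toMul h⟩

theorem abelianizationForm_apply (φ : invariantHoms (ZMod n) (ZMod n) (commutator G)) (x y : G) :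
    abelianizationForm n G φ (.ofMul (.of x)) (.ofMul (.of y)) =
      commutatorForm (ZMod n) (ZMod n) φ (.ofMul x) (.ofMul y) :=
  rfl

theorem abelianizationCoad_apply (l : invariantHoms (ZMod n) (ZMod n) (thirdLCS G)) (x : G) :
    abelianizationCoad n G l (.ofMul (.of x)) = thirdCoad (ZMod n) (ZMod n) l (.ofMul x) :=
  rfl

theorem isAlt_abelianizationForm (φ : invariantHoms (ZMod n) (ZMod n) (commutator G)) :
    (abelianizationForm n G φ).IsAlt :=
  forall_additive_abelianization.2 fun x => commutatorForm_self φ (.ofMul x)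

theorem IsCaminaGroup.nondegenerate_abelianizationForm (hG : IsCaminaGroup G)
    {φ : invariantHoms (ZMod n) (ZMod n) (commutator G)} (hφ : φ ≠ 0) :
    (abelianizationForm n G φ).Nondegenerate := by
  refine (isAlt_abelianizationForm φ).isRefl.nondegenerate_iff_separatingLeft.2 <|
    forall_additive_abelianization.2 fun x hx => ?_
  exact (QuotientGroup.eq_one_iff x).2 <| hG.mem_commutator_of_commutatorForm_eq_zero hφ <|
    AddMonoidHom.ext fun y => hx (.ofMul (.of y.toMul))

theorem abelianizationForm_coad_cyclic (l : invariantHoms (ZMod n) (ZMod n) (thirdLCS G))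
    (x y z : Additive (Abelianization G)) :
    abelianizationForm n G (abelianizationCoad n G l z) x y +
      abelianizationForm n G (abelianizationCoad n G l x) y z +
        abelianizationForm n G (abelianizationCoad n G l y) z x = 0 := by
  revert x y z
  simp only [forall_additive_abelianization, abelianizationCoad_apply, abelianizationForm_apply]
  exact fun x y z => commutatorForm_thirdCoad_cyclic l (.ofMul x) (.ofMul y) (.ofMul z)

theorem abelianizationCoad_injective : Function.Injective (abelianizationCoad n G) := by
  refine (injective_iff_map_eq_zero _).2 fun l hl => ?_
  refine (map_eq_zero_iff _ thirdCoad_injective).1 (AddMonoidHom.ext fun x => ?_)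
  exact LinearMap.congr_fun hl (.ofMul (.of x.toMul))

theorem abelianizationCoad_eq_zero_iff {l : invariantHoms (ZMod n) (ZMod n) (thirdLCS G)}
    {x : G} : abelianizationCoad n G l (.ofMul (.of x)) = 0 ↔
      ∀ w, l.1 (.ofMul (thirdCommutator w x)) = 0 :=
  ⟨fun h w => DFunLike.congr_fun (congrArg Subtype.val h) (.ofMul w),
    fun h => Subtype.ext (AddMonoidHom.ext fun w => h w.toMul)⟩

end Abelianization

section CentralizerFamily

open scoped commutatorElement

variable {G : Type*} [Group G] {p : ℕ}

theorem mem_centralizerMod_iff {N : Subgroup G} [N.Normal] {x : G} :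
    x ∈ centralizerMod N ↔ ∀ w ∈ commutator G, ⁅w, x⁆ ∈ N := by
  have hcomm (w : G) : QuotientGroup.mk' N w * QuotientGroup.mk' N x =
      QuotientGroup.mk' N x * QuotientGroup.mk' N w ↔ ⁅w, x⁆ ∈ N := by
    rw [← commutatorElement_eq_one_iff_mul_comm, ← map_commutatorElement,
      QuotientGroup.mk'_apply, QuotientGroup.eq_one_iff]
  rw [centralizerMod, Subgroup.mem_comap, Subgroup.mem_centralizer_iff, Subgroup.coe_map,
    Set.forall_mem_image]
  exact forall₂_congr fun w _ => hcomm w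

/-- The kernel of a homomorphism from `H` to `ℤ/p`, as a subgroup of `G`. -/
def invariantKer {H : Subgroup G} (l : invariantHoms (ZMod p) (ZMod p) H) : Subgroup G :=
  (AddMonoidHom.toMultiplicativeRight l.1).ker.map H.subtype

theorem mem_invariantKer_iff {H : Subgroup G} {l : invariantHoms (ZMod p) (ZMod p) H} {z : H} :
    (z : G) ∈ invariantKer l ↔ l.1 (.ofMul z) = 0 :=
  Subgroup.mem_map_iff_mem H.subtype_injective

theorem invariantKer_le {H : Subgroup G} (l : invariantHoms (ZMod p) (ZMod p) H) :
    invariantKer l ≤ H :=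
  Subgroup.map_subtype_le _

instance invariantKer_normal {H : Subgroup G} [H.Normal]
    (l : invariantHoms (ZMod p) (ZMod p) H) : (invariantKer l).Normal where
  conj_mem := by
    rintro _ ⟨z, hz, rfl⟩ x
    have hmem : x * z * x⁻¹ ∈ H := Subgroup.Normal.conj_mem inferInstance _ z.2 x
    exact ⟨⟨_, hmem⟩, (invariantHoms_conj_apply l x z hmem).trans hz, rfl⟩

theorem relIndex_invariantKer (hp : p.Prime) {H : Subgroup G}
    {l : invariantHoms (ZMod p) (ZMod p) H} (hl : l ≠ 0) : (invariantKer l).relIndex H = p := by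
  set f := AddMonoidHom.toMultiplicativeRight l.1
  have hcard : Nat.card (Multiplicative (ZMod p)) = p :=
    (Nat.card_congr Multiplicative.toAdd).trans (Nat.card_zmod p)
  have : Fact (Nat.card (Multiplicative (ZMod p))).Prime := ⟨by rwa [hcard]⟩
  have hrange : f.range = ⊤ := f.range.eq_bot_or_eq_top_of_prime_card.resolve_left fun h =>
    hl <| Subtype.ext <| AddMonoidHom.toMultiplicativeRight.injective (f.range_eq_bot_iff.1 h)
  rw [Subgroup.relIndex, Subgroup.subgroupOf, invariantKer,
    Subgroup.comap_map_eq_self_of_injective H.subtype_injective, Subgroup.index_ker, hrange,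
    Subgroup.card_top, hcard]

theorem mem_centralizerMod_invariantKer_iff [Module (ZMod p) (Additive (Abelianization G))]
    {l : invariantHoms (ZMod p) (ZMod p) (thirdLCS G)} {x : G} [(invariantKer l).Normal] :
    x ∈ centralizerMod (invariantKer l) ↔
      .ofMul (.of x) ∈ LinearMap.ker (abelianizationCoad p G l) := by
  rw [LinearMap.mem_ker, abelianizationCoad_eq_zero_iff, mem_centralizerMod_iff]
  exact ⟨fun h w => mem_invariantKer_iff.1 (h w w.2),
    fun h w hw => mem_invariantKer_iff (z := thirdCommutator ⟨w, hw⟩ x).2 (h ⟨w, hw⟩)⟩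

theorem ncard_ker_abelianizationCoad_le [Finite G] (hp : p.Prime)
    [Module (ZMod p) (Additive (Abelianization G))] :
    {C | ∃ l ≠ 0, LinearMap.ker (abelianizationCoad p G l) = C}.ncard ≤
      (centralizerFamily G p).ncard := by
  refine Set.ncard_le_ncard_of_injOn
    (fun C => (AddSubgroup.toSubgroup' C.toAddSubgroup).comap Abelianization.of) ?_ ?_
    (Set.toFinite _)
  · rintro _ ⟨l, hl, rfl⟩
    have : (invariantKer l).Normal := invariantKer_normal (H := ⁅commutator G, (⊤ : Subgroup G)⁆) l
    exact ⟨invariantKer l, this, invariantKer_le l, relIndex_invariantKer hp hl,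
      Subgroup.ext fun _ => mem_centralizerMod_invariantKer_iff.symm⟩
  · exact fun C _ D _ h => Submodule.ext <| forall_additive_abelianization.2 (SetLike.ext_iff.1 h)

theorem eq_zero_of_forall_abelianizationCoad_eq_zero (hp : p.Prime)
    (hcenter : thirdLCS G ≤ Subgroup.center G) (hpow : ∀ z ∈ thirdLCS G, z ^ p = 1)
    (hcent : Subgroup.centralizer (commutator G : Set G) ≤ commutator G)
    [Module (ZMod p) (Additive (Abelianization G))] :
    ∀ v, (∀ l, abelianizationCoad p G l v = 0) → v = 0 := by
  refine forall_additive_abelianization.2 fun x hx => (QuotientGroup.eq_one_iff x).2 <|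
    hcent <| Subgroup.mem_centralizer_iff.2 fun w hw => ?_
  by_contra hne
  obtain ⟨l, hl⟩ := exists_invariantHoms_apply_ne_zero_of_le_center hp hcenter hpow
    (z := thirdCommutator ⟨w, hw⟩ x)
    fun h => hne (commutatorElement_eq_one_iff_mul_comm.1 (congrArg Subtype.val h))
  exact hl (abelianizationCoad_eq_zero_iff.1 (hx l) _)

end CentralizerFamily

theorem theorem4p6_general {G : Type*} [Group G] [Finite G] {p : ℕ} (hp : p.Prime)
    (hpG : IsPGroup p G) (hCamina : IsCaminaGroup G) (hclass : Group.nilpotencyClass G = 3)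
    (hcent : Subgroup.centralizer (commutator G : Set G) ≤ commutator G) :
    Nat.card (thirdLCS G) ≤ ((centralizerFamily G p).ncard - 1) ^ 2 := by
  have : Fact p.Prime := ⟨hp⟩
  have hcenter := thirdLCS_le_center hclass
  have hpow := hCamina.pow_prime_mem_commutator hp hpG hclass
  have hpow' := thirdLCS_pow_eq_one hcenter hpow
  have : Module (ZMod p) (Additive (Abelianization G)) := AddCommGroup.zmodModule <|
    forall_additive_abelianization.2 fun x => (QuotientGroup.eq_one_iff _).2 (hpow x)
  have hcard := natCard_invariantHoms_of_le_center hp hcenter hpow'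
  have : Nontrivial (invariantHoms (ZMod p) (ZMod p) (thirdLCS G)) :=
    Finite.one_lt_card_iff_nontrivial.1 <| hcard ▸
      Subgroup.one_lt_card_iff_ne_bot _ |>.2 (thirdLCS_ne_bot hclass)
  rw [← hcard]
  calc Nat.card (invariantHoms (ZMod p) (ZMod p) (thirdLCS G))
      ≤ ({C | ∃ l ≠ 0, LinearMap.ker (abelianizationCoad p G l) = C}.ncard - 1) ^ 2 :=
        natCard_le_sq_of_jacobi (B := abelianizationForm p G) isAlt_abelianizationForm
          (fun _ hφ => hCamina.nondegenerate_abelianizationForm hφ) abelianizationForm_coad_cyclic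
          abelianizationCoad_injective
          (eq_zero_of_forall_abelianizationCoad_eq_zero hp hcenter hpow' hcent)
    _ ≤ ((centralizerFamily G p).ncard - 1) ^ 2 :=
        Nat.pow_le_pow_left (Nat.sub_le_sub_right (ncard_ker_abelianizationCoad_le hp) 1) 2

theorem theorem4p6 {G : Type*} [Group G] [Finite G] (p : ℕ) (hp : p.Prime)
    (hpG : IsPGroup p G) (hCamina : IsCaminaGroup G) (hclass : Group.nilpotencyClass G = 3)
    (hcent : Subgroup.centralizer (commutator G : Set G) = commutator G)
    (a : ℕ) (ha : 1 ≤ a) (hcard : (centralizerFamily G p).ncard ≤ p ^ a + 1) :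
    Nat.card (thirdLCS G) ≤ p ^ (2 * a) := by
  rw [mul_comm, pow_mul]
  exact (theorem4p6_general hp hpG hCamina hclass hcent.le).trans
    (Nat.pow_le_pow_left (Nat.sub_le_of_le_add hcard) 2)
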